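/- Let $q\ge 2$. An $(n,m)$-multigraph is a graph on the labelled vertex set $\{1,\dots,n\}$ with $m$ unlabelled edges, loops and multiple edges being allowed. Its compensation factor is $\kappa(G)=\operatorname{seqv}(G)/(2^m m!)$, where $\operatorname{seqv}(G)$ is the number of sequences of vertices $v_1w_1\dots v_mw_m$ such that the multiset $\{\{v_i,w_i\} : 1\le i\le m\}$ is the multiset of edges of $G$; thus $\kappa(G)=1$ when $G$ is simple, that is, has neither loops nor multiple edges. The *number* of graphs in a family of (coloured) multigraphs means the sum of their compensation factors (for a family of simple graphs this is its cardinality). A properly $q$-coloured multigraph is a multigraph with a colour in $\{1,\dots,q\}$ for each vertex such that no edge links two vertices of the same colour. Given an irreducible symmetric $q\times q$ matrix $R$ and a vector $r$ of size $q$, both with non-negative coefficients, an $(n,m)$-$(R,r)$-graph is an $(n,m)$-multigraph $G$ in which each vertex $v$ has a type $t(v)\in\{1,\dots,q\}$. Its weight is $\omega(G)=\kappa(G)\prod_{v} r_{t(v)}\prod_{\{v,w\}} R_{t(v),t(w)}$, where the products run over the vertices and over the edges (with multiplicity) of $G$, and the *number* of $(n,m)$-$(R,r)$-graphs is the sum of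 their weights. Let $R^{(\mathrm{col})}$ be the $q\times q$ matrix with all coefficients equal to $1$, except on the diagonal where they are equal to $0$, and let $\mathbf 1$ be the vector with all coefficients equal to $1$. Then, for all $n,m\ge 0$, the number of properly $q$-coloured $(n,m)$-multigraphs is equal to the number of $(n,m)$-$(R^{(\mathrm{col})},\mathbf 1)$-graphs. Moreover, for every compact set $K\subset\mathbb R_{>0}$, as $n\to\infty$ and uniformly over all $m$ with $m/n\in K$, this number is $$\frac{n^{2m}}{2^m m!}\left(1+\frac{2}{q-1}\frac mn\right)^{-\frac{q-1}{2}}\left(1-\frac1q\right)^m q^n\,\bigl(1+o(1)\bigr),$$ and the number of properly $q$-coloured simple $(n,m)$-graphs is $$\frac{n^{2m}}{2^m m!}\left(1+\frac{2}{q-1}\frac mn\right)^{-\frac{q-1}{2}}\left(1-\frac1q\right)^m q^n\,\exp\left(-\left(\frac mn\right)^2\frac{q}{q-1}\right)\bigl(1+o(1)\bigr).$$ -/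

import Mathlib

/-- A vertex-labelled multigraph with vertex set `{0, …, n-1}` and `m` edges, loops and multiple
edges being allowed: its edges form a multiset of `m` unordered pairs of vertices. -/
abbrev Multigraph (n m : ℕ) : Type := Sym (Sym2 (Fin n)) m

namespace Multigraph

variable {n m : ℕ}

/-- The number of ordered sequences of vertices `v₁ w₁ … v_m w_m` whose edges
`{v₁, w₁}, …, {v_m, w_m}` (counted with multiplicity) are those of `G`. -/
noncomputable def seqv (G : Multigraph n m) : ℕ :=
  Nat.card {s : Fin m → Fin n × Fin n //
    Finset.univ.val.map (fun i => s((s i).1, (s i).2)) = (G : Multiset (Sym2 (Fin n)))}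

/-- The compensation factor `κ(G) = seqv(G) / (2 ^ m * m!)`. -/
noncomputable def kappa (G : Multigraph n m) : ℝ :=
  (G.seqv : ℝ) / (2 ^ m * (m.factorial : ℝ))

/-- A multigraph is simple if it has neither loops nor multiple edges. -/
def IsSimple (G : Multigraph n m) : Prop :=
  (∀ e ∈ G, ¬ e.IsDiag) ∧ (G : Multiset (Sym2 (Fin n))).Nodup

end Multigraph

/-- An `(n,m)`-multigraph together with a type (or colour) in a set of `q` elements for each
vertex. -/
abbrev TypedMultigraph (q n m : ℕ) : Type := Multigraph n m × (Fin n → Fin q)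

/-- No edge links two vertices of the same colour (in particular, there are no loops). -/
def IsProperlyColored {q n m : ℕ} (G : TypedMultigraph q n m) : Prop :=
  ∀ v w : Fin n, s(v, w) ∈ G.1 → G.2 v ≠ G.2 w

open Classical in
/-- The number of graphs in a family of coloured multigraphs: the sum of their compensation
factors. -/
noncomputable def numberOfGraphs {q n m : ℕ} (F : Set (TypedMultigraph q n m)) : ℝ :=
  ∑ G : TypedMultigraph q n m with G ∈ F, G.1.kappa

/-- The number of properly `q`-coloured `(n,m)`-multigraphs. -/
noncomputable def numProperlyColored (q n m : ℕ) : ℝ :=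
  numberOfGraphs {G : TypedMultigraph q n m | IsProperlyColored G}

/-- The number of properly `q`-coloured simple `(n,m)`-graphs. -/
noncomputable def numProperlyColoredSimple (q n m : ℕ) : ℝ :=
  numberOfGraphs {G : TypedMultigraph q n m | IsProperlyColored G ∧ G.1.IsSimple}

/-- The parameters `(R, r)` of a model of inhomogeneous graphs: an irreducible symmetric `q × q`
matrix `R` with non-negative coefficients (non-negativity is part of `Matrix.IsIrreducible`) and a
vector `r` with non-negative coefficients. -/
structure InhomogeneousModel (q : ℕ) where
  R : Matrix (Fin q) (Fin q) ℝ
  r : Fin q → ℝ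
  symm : R.IsSymm
  irreducible : R.IsIrreducible
  r_nonneg : ∀ i, 0 ≤ r i

namespace InhomogeneousModel

variable {q n m : ℕ} (M : InhomogeneousModel q)

/-- The weight `R_{t(v), t(w)}` of an edge `{v, w}`, when the vertices have types `t`. -/
def edgeWeight (t : Fin n → Fin q) : Sym2 (Fin n) → ℝ :=
  Sym2.lift ⟨fun v w => M.R (t v) (t w), fun v w => (M.symm.apply (t v) (t w)).symm⟩

/-- The weight `ω(G)` of an `(R,r)`-graph: the product of the compensation factor, of the weights
of the vertices, and of the weights of the edges (with multiplicity). -/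
noncomputable def weight (G : TypedMultigraph q n m) : ℝ :=
  G.1.kappa * (∏ u, M.r (G.2 u)) *
    ((G.1 : Multiset (Sym2 (Fin n))).map (M.edgeWeight G.2)).prod

/-- The number of `(n,m)`-`(R,r)`-graphs: the sum of the weights of all of them. -/
noncomputable def numGraphs (n m : ℕ) : ℝ :=
  ∑ G : TypedMultigraph q n m, M.weight G

end InhomogeneousModel

/-- The `q × q` matrix with all coefficients equal to `1`, except on the diagonal where they
are `0`. -/
def colMatrix (q : ℕ) : Matrix (Fin q) (Fin q) ℝ :=
  Matrix.of fun i j => if i = j then 0 else 1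

theorem colMatrix_isSymm (q : ℕ) : (colMatrix q).IsSymm := by
  ext i j
  simp [colMatrix, Matrix.transpose_apply, eq_comm]

theorem colMatrix_isIrreducible (q : ℕ) (hq : 2 ≤ q) : (colMatrix q).IsIrreducible := by
  have hpos : ∀ i j : Fin q, i ≠ j → 0 < colMatrix q i j := by
    intro i j h
    simp [colMatrix, h]
  refine ⟨fun i j => ?_, ?_⟩
  · by_cases h : i = j <;> simp [colMatrix, h]
  · let : Quiver (Fin q) := Matrix.toQuiver (colMatrix q)
    intro i j
    by_cases h : i = j
    · subst h
      have : Nontrivial (Fin q) := Fin.nontrivial_iff_two_le.mpr hq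
      obtain ⟨k, hk⟩ := exists_ne i
      exact ⟨(Quiver.Path.nil.cons (PLift.up (hpos i k hk.symm))).cons
        (PLift.up (hpos k i hk)), by simp⟩
    · exact ⟨Quiver.Path.nil.cons (PLift.up (hpos i j h)), by simp⟩

/-- The model with matrix `colMatrix q` in which all vertex weights are `1`. -/
def colModel (q : ℕ) (hq : 2 ≤ q) : InhomogeneousModel q where
  R := colMatrix q
  r := fun _ => 1
  symm := colMatrix_isSymm q
  irreducible := colMatrix_isIrreducible q hq
  r_nonneg := fun _ => zero_le_one

/-- `n^{2m} / (2^m m!) * (1 + 2/(q-1) * m/n)^{-(q-1)/2} * (1 - 1/q)^m * q^n`. -/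
noncomputable def coloredAsymptotics (q n m : ℕ) : ℝ :=
  (n : ℝ) ^ (2 * m) / (2 ^ m * (m.factorial : ℝ)) *
    (1 + 2 / ((q : ℝ) - 1) * ((m : ℝ) / (n : ℝ))) ^ (-(((q : ℝ) - 1) / 2)) *
    (1 - 1 / (q : ℝ)) ^ m * (q : ℝ) ^ n

/-!
Summing compensation factors over the multigraphs of a family amounts to counting the sequences of
`m` ordered pairs of vertices whose multigraph is in the family, divided by `2 ^ m * m!`
(`Multigraph.sum_kappa`). For a fixed colouring `t` with colour counts `n_c`, the properly coloured
sequences are those that use only bichromatic pairs, of which there are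
`n ^ 2 - ∑ n_c ^ 2 = n ^ 2 * (1 - 1 / q) * (1 - u)`, where `u` (`imbalance`) is proportional to the
squared norm of the vector `Y` (`deviation`) of the `n_c - n / q`. So the number of properly
coloured multigraphs is `n ^ (2 * m) / (2 ^ m * m!) * (1 - 1 / q) ^ m * q ^ n` times the average of
`(1 - u) ^ m` over all colourings (`numProperlyColored_eq_average`).

For `u ∈ [0, 1]`, `(1 - u) ^ m` is `exp (-m * u)` up to `O(1 / m)`. As `m * u` has the form
`τ ^ 2 / 2 * ‖Y‖ ^ 2`, its exponential is a Gaussian integral of `exp (i * τ * ⟪Y, v⟫)` over the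
hyperplane `∑ v_c = 0`, and the average of the latter over all colourings is the `n`-th power of a
sum of `q` terms (`gaussian_transform`). This power converges to a Gaussian function of `v`, by a
second-order expansion, and dominated convergence gives the Gaussian integral whose value is
`(1 + 2 / (q - 1) * α) ^ (-(q - 1) / 2)` with `α = lim m / n` (`tendsto_laplace_deviation`).

For simple graphs, the weight of a colouring with `b` bichromatic edges is further multiplied by the
probability that `m` uniform elements among `b` are distinct (`distinctProb`), which is close to
`exp (-m ^ 2 / (2 * b))`. Colourings with `u ≥ 1 / √m` contribute at most `exp (-√m)`; for the others
`b` is equivalent to `n ^ 2 * (1 - 1 / q) / 2`, so that this factor tends to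
`exp (-α ^ 2 * q / (q - 1))` uniformly (`tendsto_average_distinctProb`).

Uniformity over a compact set of values of `m / n` follows from the convergence along all sequences
with `m / n` convergent (`exists_forall_of_eventually`).
-/

open Filter Topology

/-! ### Counting sequences of vertices -/

namespace Multigraph

variable {n m : ℕ}

/-- The multigraph whose edges are the pairs of a sequence of ordered pairs of vertices. -/
def ofPairs (s : Fin m → Fin n × Fin n) : Multigraph n m :=
  ⟨Finset.univ.val.map fun i => s((s i).1, (s i).2), by simp⟩

theorem mem_ofPairs {s : Fin m → Fin n × Fin n} {e : Sym2 (Fin n)} :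
    e ∈ ofPairs s ↔ ∃ i, s((s i).1, (s i).2) = e := by
  change e ∈ (Finset.univ : Finset (Fin m)).val.map (fun i => s((s i).1, (s i).2)) ↔ _
  simp

theorem nodup_ofPairs {s : Fin m → Fin n × Fin n} :
    (ofPairs s : Multiset (Sym2 (Fin n))).Nodup ↔
      Function.Injective fun i => s((s i).1, (s i).2) := by
  change ((Finset.univ : Finset (Fin m)).val.map (fun i => s((s i).1, (s i).2))).Nodup ↔ _
  rw [← Set.injOn_univ, ← Finset.coe_univ]
  exact Finset.nodup_map_iff_injOn

open Classical in
theorem seqv_eq_card (G : Multigraph n m) :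
    G.seqv = (Finset.univ.filter fun s : Fin m → Fin n × Fin n => ofPairs s = G).card := by
  rw [seqv, Nat.card_eq_fintype_card, Fintype.card_subtype]
  congr 1
  ext s
  simp only [Finset.mem_filter, Finset.mem_univ, true_and]
  exact (Subtype.ext_iff (a1 := ofPairs s) (a2 := G)).symm

open Classical in
/-- Weighting by compensation factors amounts to counting sequences of pairs of vertices. -/
theorem sum_kappa (P : Multigraph n m → Prop) :
    ∑ G with P G, G.kappa =
      (Finset.univ.filter fun s : Fin m → Fin n × Fin n => P (ofPairs s)).card /
        (2 ^ m * (m.factorial : ℝ)) := by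
  simp only [kappa]
  rw [← Finset.sum_div, ← Nat.cast_sum]
  congr 2
  rw [Finset.card_eq_sum_card_fiberwise (f := ofPairs) (t := Finset.univ.filter P)
    (fun s hs => by simpa using hs)]
  refine Finset.sum_congr rfl fun G hG => ?_
  rw [seqv_eq_card, Finset.filter_filter]
  congr 1
  ext s
  simp only [Finset.mem_filter, Finset.mem_univ, true_and] at hG ⊢
  exact ⟨fun h => ⟨h ▸ hG, h⟩, fun h => h.2⟩

end Multigraph

open Classical in
theorem numberOfGraphs_eq_sum {q n m : ℕ} (F : Set (TypedMultigraph q n m)) :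
    numberOfGraphs F = ∑ t : Fin n → Fin q, ∑ G : Multigraph n m with (G, t) ∈ F, G.kappa := by
  simp only [numberOfGraphs, Finset.sum_filter]
  rw [Fintype.sum_prod_type_right]

theorem numProperlyColored_eq_numGraphs (q : ℕ) (hq : 2 ≤ q) (n m : ℕ) :
    numProperlyColored q n m = (colModel q hq).numGraphs n m := by
  classical
  simp only [numProperlyColored, numberOfGraphs, InhomogeneousModel.numGraphs, Finset.sum_filter]
  refine Finset.sum_congr rfl fun G _ => ?_
  simp only [InhomogeneousModel.weight, colModel, Finset.prod_const_one, mul_one]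
  split_ifs with h
  · rw [Multiset.prod_eq_one, mul_one]
    intro x hx
    obtain ⟨e, he, rfl⟩ := Multiset.mem_map.1 hx
    induction e with | _ v w
    simp [InhomogeneousModel.edgeWeight, colMatrix, h v w he]
  · simp only [Set.mem_ofPred_eq, IsProperlyColored, not_forall, not_not] at h
    obtain ⟨v, w, he, hvw⟩ := h
    rw [Multiset.prod_eq_zero, mul_zero]
    exact Multiset.mem_map.2 ⟨_, he, by simp [InhomogeneousModel.edgeWeight, colMatrix, hvw]⟩

section Bichromatic

variable {q n : ℕ}

/-- The ordered pairs of vertices with distinct colours. -/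
def bichromaticPairs (t : Fin n → Fin q) : Finset (Fin n × Fin n) :=
  {p | t p.1 ≠ t p.2}

/-- The edges whose ends have distinct colours. -/
def bichromaticEdges (t : Fin n → Fin q) : Finset (Sym2 (Fin n)) :=
  (bichromaticPairs t).image fun p => s(p.1, p.2)

/-- The number of vertices of a given colour. -/
def colorCount (t : Fin n → Fin q) (c : Fin q) : ℕ :=
  (Finset.univ.filter fun v => t v = c).card

theorem mem_bichromaticPairs {t : Fin n → Fin q} {p : Fin n × Fin n} :
    p ∈ bichromaticPairs t ↔ t p.1 ≠ t p.2 := by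
  simp [bichromaticPairs]

theorem mk_mem_bichromaticEdges {t : Fin n → Fin q} {v w : Fin n} :
    s(v, w) ∈ bichromaticEdges t ↔ t v ≠ t w := by
  simp only [bichromaticEdges, Finset.mem_image, mem_bichromaticPairs, Prod.exists, Sym2.eq_iff]
  constructor
  · rintro ⟨a, b, h, ⟨rfl, rfl⟩ | ⟨rfl, rfl⟩⟩
    exacts [h, h.symm]
  · exact fun h => ⟨v, w, h, Or.inl ⟨rfl, rfl⟩⟩

theorem card_fiber_bichromaticEdges {t : Fin n → Fin q} {e : Sym2 (Fin n)}
    (he : e ∈ bichromaticEdges t) :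
    ((bichromaticPairs t).filter fun p => s(p.1, p.2) = e).card = 2 := by
  induction e with | _ v w
  have hvw := mk_mem_bichromaticEdges.1 he
  have hne : v ≠ w := fun h => hvw (h ▸ rfl)
  have : (bichromaticPairs t).filter (fun p => s(p.1, p.2) = s(v, w)) = {(v, w), (w, v)} := by
    ext ⟨a, b⟩
    simp only [Finset.mem_filter, mem_bichromaticPairs, Sym2.eq_iff, Finset.mem_insert,
      Finset.mem_singleton, Prod.mk.injEq]
    constructor
    · exact fun h => h.2
    · rintro (⟨rfl, rfl⟩ | ⟨rfl, rfl⟩)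
      exacts [⟨hvw, Or.inl ⟨rfl, rfl⟩⟩, ⟨hvw.symm, Or.inr ⟨rfl, rfl⟩⟩]
  rw [this, Finset.card_pair]
  simp [hne]

theorem card_bichromaticPairs (t : Fin n → Fin q) :
    (bichromaticPairs t).card = (bichromaticEdges t).card * 2 := by
  rw [Finset.card_eq_sum_card_image (fun p : Fin n × Fin n => s(p.1, p.2)),
    ← bichromaticEdges, Finset.sum_const_nat]
  exact fun e he => card_fiber_bichromaticEdges he

theorem card_bichromaticPairs_add (t : Fin n → Fin q) :
    (bichromaticPairs t).card + ∑ c, colorCount t c ^ 2 = n ^ 2 := by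
  have hmono : ∑ c, colorCount t c ^ 2 =
      (Finset.univ.filter fun p : Fin n × Fin n => t p.1 = t p.2).card := by
    rw [Finset.card_eq_sum_card_fiberwise (f := fun p : Fin n × Fin n => t p.1)
      (t := Finset.univ) (fun _ _ => by simp)]
    refine Finset.sum_congr rfl fun c _ => ?_
    rw [colorCount, sq, ← Finset.card_product]
    congr 1
    ext ⟨a, b⟩
    simp only [Finset.mem_product, Finset.mem_filter, Finset.mem_univ, true_and]
    constructor
    · rintro ⟨rfl, h⟩
      exact ⟨h.symm, rfl⟩
    · rintro ⟨h, rfl⟩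
      exact ⟨rfl, h.symm⟩
  rw [hmono, bichromaticPairs, add_comm, Finset.card_filter_add_card_filter_not]
  simp [sq]

theorem sum_colorCount (t : Fin n → Fin q) : ∑ c, colorCount t c = n := by
  have := Finset.card_eq_sum_card_fiberwise (f := t) (s := Finset.univ) (t := Finset.univ)
    (fun _ _ => by simp)
  simpa [colorCount] using this.symm

theorem numProperlyColored_eq_sum (q n m : ℕ) :
    numProperlyColored q n m =
      ∑ t : Fin n → Fin q, ((bichromaticPairs t).card : ℝ) ^ m / (2 ^ m * (m.factorial : ℝ)) := by
  classical
  rw [numProperlyColored, numberOfGraphs_eq_sum]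
  refine Finset.sum_congr rfl fun t _ => ?_
  rw [Multigraph.sum_kappa fun G => (G, t) ∈ {G : TypedMultigraph q n m | IsProperlyColored G}]
  congr 1
  have : (Finset.univ.filter fun s : Fin m → Fin n × Fin n =>
      (Multigraph.ofPairs s, t) ∈ {G : TypedMultigraph q n m | IsProperlyColored G}) =
      Fintype.piFinset fun _ => bichromaticPairs t := by
    ext s
    simp only [Finset.mem_filter, Finset.mem_univ, true_and, Set.mem_ofPred_eq, IsProperlyColored,
      Multigraph.mem_ofPairs, Fintype.mem_piFinset, ← mk_mem_bichromaticEdges]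
    constructor
    · intro h i
      exact mem_bichromaticPairs.2 (mk_mem_bichromaticEdges.1 (h _ _ ⟨i, rfl⟩))
    · rintro h v w ⟨i, hi⟩
      rw [← hi]
      exact mk_mem_bichromaticEdges.2 (mem_bichromaticPairs.1 (h i))
  rw [this]
  simp

/-- Sequences of ordered bichromatic pairs with distinct underlying edges: choose the sequence of
edges, then one of the two orientations of each edge. -/
theorem card_injective_bichromatic (t : Fin n → Fin q) (m : ℕ) :
    ((Fintype.piFinset fun _ : Fin m => bichromaticPairs t).filter fun s =>
      Function.Injective fun i => s((s i).1, (s i).2)).card =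
      (bichromaticEdges t).card.descFactorial m * 2 ^ m := by
  classical
  rw [Finset.card_eq_sum_card_fiberwise
    (f := fun (s : Fin m → Fin n × Fin n) i => s((s i).1, (s i).2))
    (t := (Fintype.piFinset fun _ : Fin m => bichromaticEdges t).filter Function.Injective)]
  · rw [Finset.sum_const_nat (m := 2 ^ m)]
    · congr 1
      rw [← Fintype.card_fin m, ← Fintype.card_coe (bichromaticEdges t),
        ← Fintype.card_embedding_eq, Fintype.card_fin, ← Finset.card_univ]
      symm
      refine Finset.card_bij (fun f _ i => (f i : Sym2 (Fin n))) ?_ ?_ ?_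
      · intro f _
        simp only [Finset.mem_filter, Fintype.mem_piFinset]
        exact ⟨fun i => (f i).2, fun i j h => f.injective (Subtype.ext h)⟩
      · intro f _ g _ h
        exact DFunLike.ext _ _ fun i => Subtype.ext (congrFun h i)
      · intro g hg
        simp only [Finset.mem_filter, Fintype.mem_piFinset] at hg
        exact ⟨⟨fun i => ⟨g i, hg.1 i⟩, fun i j h => hg.2 (Subtype.ext_iff.1 h)⟩,
          Finset.mem_univ _, rfl⟩
    · intro g hg
      simp only [Finset.mem_filter, Fintype.mem_piFinset] at hg
      have : (((Fintype.piFinset fun _ : Fin m => bichromaticPairs t).filter fun s =>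
          Function.Injective fun i => s((s i).1, (s i).2)).filter
            fun s => (fun i => s((s i).1, (s i).2)) = g) =
          Fintype.piFinset fun i => (bichromaticPairs t).filter fun p => s(p.1, p.2) = g i := by
        ext s
        simp only [Finset.mem_filter, Fintype.mem_piFinset]
        constructor
        · rintro ⟨⟨h, -⟩, rfl⟩ i
          exact ⟨h i, rfl⟩
        · intro h
          have hs : (fun i => s((s i).1, (s i).2)) = g := funext fun i => (h i).2
          exact ⟨⟨fun i => (h i).1, hs ▸ hg.2⟩, hs⟩
      rw [this, Fintype.card_piFinset, Finset.prod_congr rfl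
        fun i _ => card_fiber_bichromaticEdges (hg.1 i)]
      simp
  · intro s hs
    simp only [Finset.coe_filter, Fintype.mem_piFinset, Set.mem_ofPred_eq] at hs ⊢
    exact ⟨fun i => mk_mem_bichromaticEdges.2 (mem_bichromaticPairs.1 (hs.1 i)), hs.2⟩

theorem numProperlyColoredSimple_eq_sum (q n m : ℕ) :
    numProperlyColoredSimple q n m =
      ∑ t : Fin n → Fin q, (((bichromaticEdges t).card.descFactorial m : ℝ) * 2 ^ m) /
        (2 ^ m * (m.factorial : ℝ)) := by
  classical
  rw [numProperlyColoredSimple, numberOfGraphs_eq_sum]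
  refine Finset.sum_congr rfl fun t _ => ?_
  rw [Multigraph.sum_kappa fun G =>
    (G, t) ∈ {G : TypedMultigraph q n m | IsProperlyColored G ∧ G.1.IsSimple}]
  congr 1
  rw [← Nat.cast_ofNat (R := ℝ), ← Nat.cast_pow, ← Nat.cast_mul, ← card_injective_bichromatic]
  congr 2
  ext s
  simp only [Finset.mem_filter, Finset.mem_univ, true_and, Set.mem_ofPred_eq, IsProperlyColored,
    Multigraph.IsSimple, Multigraph.nodup_ofPairs, Multigraph.mem_ofPairs, Fintype.mem_piFinset]
  constructor
  · rintro ⟨h, -, hinj⟩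
    exact ⟨fun i => mem_bichromaticPairs.2 (h _ _ ⟨i, rfl⟩), hinj⟩
  · rintro ⟨h, hinj⟩
    have hcol : ∀ v w, (∃ i, s((s i).1, (s i).2) = s(v, w)) → t v ≠ t w := by
      rintro v w ⟨i, hi⟩
      rw [← mk_mem_bichromaticEdges, ← hi]
      exact mk_mem_bichromaticEdges.2 (mem_bichromaticPairs.1 (h i))
    refine ⟨hcol, ?_, hinj⟩
    rintro e ⟨i, rfl⟩ hdiag
    exact hcol _ _ ⟨i, rfl⟩ (congrArg t (Sym2.mk_isDiag_iff.1 hdiag))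

end Bichromatic

/-! ### The Gaussian transform of the colour counts -/

section ZeroSum

/-- The hyperplane of vectors of `ℝ^q` whose coordinates sum to zero. -/
noncomputable abbrev ZeroSum (q : ℕ) : Submodule ℝ (EuclideanSpace ℝ (Fin q)) :=
  (ℝ ∙ (WithLp.toLp 2 1 : EuclideanSpace ℝ (Fin q)))ᗮ

theorem mem_zeroSum {q : ℕ} {v : EuclideanSpace ℝ (Fin q)} : v ∈ ZeroSum q ↔ ∑ c, v c = 0 := by
  rw [Submodule.mem_orthogonal_singleton_iff_inner_right]
  simp [PiLp.inner_apply]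

theorem finrank_zeroSum {q : ℕ} (hq : 2 ≤ q) : (Module.finrank ℝ (ZeroSum q) : ℝ) = q - 1 := by
  have : Fact (Module.finrank ℝ (EuclideanSpace ℝ (Fin q)) = (q - 1) + 1) := ⟨by simp; omega⟩
  have h1 : (WithLp.toLp 2 1 : EuclideanSpace ℝ (Fin q)) ≠ 0 := by
    intro h
    have := congrArg (fun v : EuclideanSpace ℝ (Fin q) => v ⟨0, by omega⟩) h
    simp at this
  rw [Submodule.finrank_orthogonal_span_singleton (n := q - 1) h1]
  push_cast [Nat.cast_sub (show 1 ≤ q by omega)]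
  rfl

/-- The projection of a vector of the canonical basis to the hyperplane `ZeroSum q`. -/
noncomputable def centeredBasis {q : ℕ} (c : Fin q) : ZeroSum q :=
  ⟨WithLp.toLp 2 fun d => (if c = d then 1 else 0) - 1 / (q : ℝ), by
    have : NeZero q := NeZero.of_pos c.pos
    rw [mem_zeroSum]
    simp⟩

theorem inner_centeredBasis {q : ℕ} (c : Fin q) (v : ZeroSum q) :
    inner ℝ (centeredBasis c) v = v.1 c := by
  have h := mem_zeroSum.1 v.2
  simp only [centeredBasis, Submodule.coe_inner, PiLp.inner_apply, RCLike.inner_apply,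
    conj_trivial, mul_sub, Finset.sum_sub_distrib, ← Finset.sum_mul, h]
  simp

/-- The vector of the deviations of the colour counts from their mean. -/
noncomputable def deviation {q n : ℕ} (t : Fin n → Fin q) : ZeroSum q :=
  ∑ j, centeredBasis (t j)

theorem deviation_apply {q n : ℕ} (t : Fin n → Fin q) (c : Fin q) :
    (deviation t).1 c = colorCount t c - n / q := by
  simp [deviation, centeredBasis, colorCount, div_eq_mul_inv]

theorem norm_sq_deviation {q n : ℕ} (hq : 2 ≤ q) (t : Fin n → Fin q) :
    ‖deviation t‖ ^ 2 = ∑ c, (colorCount t c : ℝ) ^ 2 - (n : ℝ) ^ 2 / q := by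
  have h : ∑ c, (colorCount t c : ℝ) = n := by exact_mod_cast sum_colorCount t
  have hq0 : (q : ℝ) ≠ 0 := by positivity
  rw [Submodule.coe_norm, EuclideanSpace.norm_sq_eq]
  simp only [deviation_apply, Real.norm_eq_abs, sq_abs, sub_sq, Finset.sum_add_distrib,
    Finset.sum_sub_distrib, ← Finset.sum_mul, ← Finset.mul_sum, h]
  simp
  field_simp
  ring

/-- The Hubbard–Stratonovich transform: the Laplace transform of the squared norm of the deviation
is a Gaussian average of its characteristic function, which is an `n`-th power. -/
theorem gaussian_transform {q : ℕ} (n : ℕ) (τ : ℝ) :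
    (2 * Real.pi : ℂ) ^ (Module.finrank ℝ (ZeroSum q) / 2 : ℂ) *
        ∑ t : Fin n → Fin q, Complex.exp (-(τ ^ 2 / 2 * ‖deviation t‖ ^ 2 : ℝ)) =
      ∫ v : ZeroSum q, Complex.exp (-(1 / 2) * ‖v‖ ^ 2) *
        (∑ c, Complex.exp (τ * v.1 c * Complex.I)) ^ n := by
  have hb : 0 < (1 / 2 : ℂ).re := by norm_num
  have key (t : Fin n → Fin q) := GaussianFourier.integral_cexp_neg_mul_sq_norm_add hb
    (τ * Complex.I) (deviation t)
  have hint (t : Fin n → Fin q) := GaussianFourier.integrable_cexp_neg_mul_sq_norm_add hb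
    (τ * Complex.I) (deviation t)
  rw [Finset.mul_sum]
  trans ∑ t : Fin n → Fin q, ∫ v : ZeroSum q,
    Complex.exp (-(1 / 2) * ‖v‖ ^ 2 + τ * Complex.I * (inner ℝ (deviation t) v : ℝ))
  · refine Finset.sum_congr rfl fun t _ => ?_
    rw [key]
    congr 2
    · ring
    · push_cast [mul_pow, Complex.I_sq]
      ring
  · rw [← MeasureTheory.integral_finsetSum _ fun t _ => hint t]
    refine MeasureTheory.integral_congr_ae (Eventually.of_forall fun v => ?_)
    simp only [Fintype.sum_pow, Finset.mul_sum]
    refine Finset.sum_congr rfl fun t _ => ?_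
    rw [Complex.exp_add, ← Complex.exp_sum, deviation, sum_inner]
    congr 2
    simp only [inner_centeredBasis]
    push_cast
    rw [Finset.mul_sum]
    exact Finset.sum_congr rfl fun j _ => by ring

end ZeroSum

section Limits

variable {ι : Type*} {l : Filter ι} {n : ι → ℕ}

theorem tendsto_one_add_pow_exp {g : ι → ℂ} {z : ℂ} (hn : Tendsto n l atTop)
    (hg : Tendsto (fun k => (n k : ℂ) * g k) l (𝓝 z)) :
    Tendsto (fun k => (1 + g k) ^ n k) l (𝓝 (Complex.exp z)) := by
  have hninv : Tendsto (fun k => ((n k : ℂ))⁻¹) l (𝓝 0) :=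
    (tendsto_inv_atTop_nhds_zero_nat (𝕜 := ℂ)).comp hn
  have hn0 : ∀ᶠ k in l, (n k : ℂ) ≠ 0 := by
    filter_upwards [hn.eventually_ge_atTop 1] with k hk
    exact_mod_cast (by omega : n k ≠ 0)
  have hg0 : Tendsto g l (𝓝 0) := by
    have := hninv.mul hg
    rw [zero_mul] at this
    refine this.congr' ?_
    filter_upwards [hn0] with k hk
    field_simp
  have hgn : Tendsto (fun k => ‖g k‖) l (𝓝 0) := by simpa using hg0.norm
  have hsmall : ∀ᶠ k in l, ‖g k‖ < 1 := hgn.eventually_lt_const one_pos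
  have hrem : Tendsto (fun k => (n k : ℂ) * (Complex.log (1 + g k) - g k)) l (𝓝 0) := by
    have hbd : Tendsto (fun k => ‖(n k : ℂ) * g k‖ * (‖g k‖ * (1 - ‖g k‖)⁻¹ / 2)) l (𝓝 0) := by
      have h1 : Tendsto (fun k => (1 - ‖g k‖)⁻¹) l (𝓝 (1 - 0)⁻¹) :=
        (tendsto_const_nhds.sub hgn).inv₀ (by norm_num)
      simpa using hg.norm.mul ((hgn.mul h1).div_const 2)
    refine squeeze_zero_norm' ?_ hbd
    filter_upwards [hsmall] with k hk
    rw [norm_mul, norm_mul]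
    calc _ ≤ ‖(n k : ℂ)‖ * (‖g k‖ ^ 2 * (1 - ‖g k‖)⁻¹ / 2) := by
          gcongr
          exact Complex.norm_log_one_add_sub_self_le hk
      _ = _ := by ring
  have hsum : Tendsto (fun k => (n k : ℂ) * Complex.log (1 + g k)) l (𝓝 z) := by
    have := hg.add hrem
    rw [add_zero] at this
    exact this.congr fun k => by ring
  refine ((Complex.continuous_exp.tendsto z).comp hsum).congr' ?_
  filter_upwards [hsmall] with k hk
  have hne : 1 + g k ≠ 0 := by
    intro h
    rw [eq_neg_of_add_eq_zero_right h] at hk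
    simp at hk
  rw [Function.comp_apply, Complex.exp_nat_mul, Complex.exp_log hne]

/-- The second-order expansion of `exp (τ * x * I)` as `τ → 0`, at the scale `n * τ ^ 2 → σ`. -/
theorem tendsto_mul_exp_sub_one_sub {τ : ι → ℝ} {σ : ℝ} (hτ : Tendsto τ l (𝓝 0))
    (hσ : Tendsto (fun k => n k * τ k ^ 2) l (𝓝 σ)) (x : ℝ) :
    Tendsto (fun k => (n k : ℂ) *
      (Complex.exp (τ k * x * Complex.I) - 1 - τ k * x * Complex.I)) l
      (𝓝 (-(σ * x ^ 2 / 2))) := by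
  have hrem : Tendsto (fun k => (n k : ℂ) * (Complex.exp (τ k * x * Complex.I) -
      ∑ i ∈ Finset.range 3, (τ k * x * Complex.I) ^ i / i.factorial)) l (𝓝 0) := by
    have hbd : Tendsto (fun k => (n k * τ k ^ 2) * (|τ k| * |x| ^ 3 * Real.exp (|τ k| * |x|))) l
        (𝓝 0) := by
      have h0 : Tendsto (fun k => |τ k|) l (𝓝 0) := by simpa using hτ.abs
      have h1 := (Real.continuous_exp.tendsto _).comp (h0.mul_const |x|)
      simpa using hσ.mul ((h0.mul_const (|x| ^ 3)).mul h1)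
    refine squeeze_zero_norm (fun k => ?_) hbd
    have hz : ‖(τ k * x * Complex.I : ℂ)‖ = |τ k| * |x| := by simp
    rw [norm_mul, Complex.norm_natCast]
    calc _ ≤ (n k : ℝ) * (‖(τ k * x * Complex.I : ℂ)‖ ^ 3 *
          Real.exp ‖(τ k * x * Complex.I : ℂ)‖) := by
          gcongr
          exact Complex.norm_exp_sub_sum_le_norm_mul_exp _ 3
      _ = _ := by
          rw [hz, ← sq_abs (τ k)]
          ring
  have hmain : Tendsto (fun k => ((-(n k * τ k ^ 2 * x ^ 2 / 2) : ℝ) : ℂ)) l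
      (𝓝 ((-(σ * x ^ 2 / 2) : ℝ) : ℂ)) :=
    (Complex.continuous_ofReal.tendsto _).comp ((hσ.mul_const _).div_const 2).neg
  have := hrem.add hmain
  push_cast at this
  rw [zero_add] at this
  refine this.congr fun k => ?_
  simp [Finset.sum_range_succ, mul_pow, Complex.I_sq, Nat.factorial]
  ring

/-- The central limit theorem for the colour counts, as convergence of characteristic functions. -/
theorem tendsto_charFun_pow {q : ℕ} (hq : 2 ≤ q) {τ : ι → ℝ} {σ : ℝ} (hn : Tendsto n l atTop)
    (hτ : Tendsto τ l (𝓝 0)) (hσ : Tendsto (fun k => n k * τ k ^ 2) l (𝓝 σ)) (v : ZeroSum q) :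
    Tendsto (fun k => ((∑ c, Complex.exp (τ k * v.1 c * Complex.I)) / q) ^ n k) l
      (𝓝 (Complex.exp (-(σ / (2 * q)) * ‖v‖ ^ 2))) := by
  have hq0 : (q : ℂ) ≠ 0 := by exact_mod_cast (by omega : q ≠ 0)
  have hv : ∑ c, (v.1 c : ℂ) = 0 := by exact_mod_cast mem_zeroSum.1 v.2
  have hv2 : (‖v‖ : ℂ) ^ 2 = ∑ c, (v.1 c : ℂ) ^ 2 := by
    have : ‖v‖ ^ 2 = ∑ c, (v.1 c) ^ 2 := by
      rw [Submodule.coe_norm, EuclideanSpace.norm_sq_eq]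
      simp
    exact_mod_cast this
  have hsum := (tendsto_finsetSum Finset.univ
    fun c _ => tendsto_mul_exp_sub_one_sub hτ hσ (v.1 c)).div_const (q : ℂ)
  refine (tendsto_one_add_pow_exp
    (g := fun k => (∑ c, Complex.exp (τ k * v.1 c * Complex.I)) / q - 1) hn ?_).congr
      fun k => by rw [add_sub_cancel]
  convert hsum using 2 with k
  · rw [← Finset.mul_sum, Finset.sum_sub_distrib, Finset.sum_sub_distrib, ← Finset.sum_mul,
      ← Finset.mul_sum, hv]
    simp only [Finset.sum_const, Finset.card_univ, Fintype.card_fin, nsmul_eq_mul, mul_one,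
      mul_zero, zero_mul, sub_zero]
    rw [div_sub_one hq0, mul_div_assoc]
  · rw [hv2, Finset.sum_neg_distrib, ← Finset.sum_div, ← Finset.mul_sum]
    ring

/-- The Laplace transform of the squared norm of the rescaled deviation converges to that of a
chi-squared law with `q - 1` degrees of freedom. -/
theorem tendsto_laplace_deviation {q : ℕ} [l.IsCountablyGenerated] (hq : 2 ≤ q) {τ : ι → ℝ}
    {σ : ℝ} (hσ0 : 0 ≤ σ) (hn : Tendsto n l atTop) (hτ : Tendsto τ l (𝓝 0))
    (hσ : Tendsto (fun k => n k * τ k ^ 2) l (𝓝 σ)) :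
    Tendsto (fun k => (∑ t : Fin (n k) → Fin q, Real.exp (-(τ k ^ 2 / 2 * ‖deviation t‖ ^ 2))) /
      (q : ℝ) ^ n k) l (𝓝 ((1 + σ / q) ^ (-(((q : ℝ) - 1) / 2)))) := by
  have hq0 : (0 : ℝ) < q := by positivity
  have hqc : (q : ℂ) ≠ 0 := by exact_mod_cast hq0.ne'
  set d : ℝ := (q : ℝ) - 1 with hd
  have hfin := finrank_zeroSum hq
  have hpi : (0 : ℝ) < (2 * Real.pi) ^ (d / 2) := by positivity
  -- the prefactor of the Gaussian transform is a positive real number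
  have hpic : (2 * Real.pi : ℂ) ^ (Module.finrank ℝ (ZeroSum q) / 2 : ℂ) =
      (((2 * Real.pi) ^ (d / 2) : ℝ) : ℂ) := by
    rw [Complex.ofReal_cpow (by positivity)]
    push_cast
    rw [← Complex.ofReal_natCast (Module.finrank ℝ (ZeroSum q)), hfin]
  have hint : Tendsto (fun k => ∫ v : ZeroSum q, Complex.exp (-(1 / 2) * ‖v‖ ^ 2) *
      ((∑ c, Complex.exp (τ k * v.1 c * Complex.I)) / q) ^ n k) l
      (𝓝 (∫ v : ZeroSum q, Complex.exp (-(1 / 2) * ‖v‖ ^ 2) *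
        Complex.exp (-(σ / (2 * q)) * ‖v‖ ^ 2))) := by
    refine MeasureTheory.tendsto_integral_filter_of_dominated_convergence
      (fun v => ‖Complex.exp (-(1 / 2) * ‖v‖ ^ 2)‖) ?_ ?_ ?_ ?_
    · refine Eventually.of_forall fun k => Continuous.aestronglyMeasurable ?_
      fun_prop
    · refine Eventually.of_forall fun k => Eventually.of_forall fun v => ?_
      rw [norm_mul]
      refine mul_le_of_le_one_right (norm_nonneg _) ?_
      rw [norm_pow, norm_div, Complex.norm_natCast]
      refine pow_le_one₀ (by positivity) ((div_le_one hq0).2 ?_)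
      refine (norm_sum_le _ _).trans (le_of_eq ?_)
      simp [← Complex.ofReal_mul, Complex.norm_exp_ofReal_mul_I]
    · have := GaussianFourier.integrable_cexp_neg_mul_sq_norm_add (V := ZeroSum q)
        (b := 1 / 2) (by norm_num) 0 0
      simpa using this.norm
    · exact Eventually.of_forall fun v => (tendsto_charFun_pow hq hn hτ hσ v).const_mul _
  -- the limit is again a Gaussian integral
  have hlim : ∫ v : ZeroSum q, Complex.exp (-(1 / 2) * ‖v‖ ^ 2) *
      Complex.exp (-(σ / (2 * q)) * ‖v‖ ^ 2) =
      (((2 * Real.pi) ^ (d / 2) * (1 + σ / q) ^ (-(d / 2)) : ℝ) : ℂ) := by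
    have hb : (0 : ℝ) < 1 / 2 + σ / (2 * q) := by positivity
    have hG := GaussianFourier.integral_rexp_neg_mul_sq_norm (V := ZeroSum q) hb
    have hval : (Real.pi / (1 / 2 + σ / (2 * q))) ^ ((Module.finrank ℝ (ZeroSum q) : ℝ) / 2) =
        (2 * Real.pi) ^ (d / 2) * (1 + σ / q) ^ (-(d / 2)) := by
      rw [hfin, Real.rpow_neg (by positivity), ← Real.inv_rpow (by positivity),
        ← Real.mul_rpow (by positivity) (by positivity)]
      congr 1
      field_simp
    rw [← hval, ← hG, ← integral_complex_ofReal]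
    refine MeasureTheory.integral_congr_ae (Eventually.of_forall fun v => ?_)
    simp only [← Complex.exp_add]
    push_cast
    congr 1
    ring
  rw [hlim] at hint
  have hre := (Complex.continuous_re.tendsto _).comp hint
  rw [Complex.ofReal_re] at hre
  have hdiv := hre.const_mul ((2 * Real.pi) ^ (d / 2))⁻¹
  rw [inv_mul_cancel_left₀ hpi.ne'] at hdiv
  refine hdiv.congr fun k => ?_
  have hk := gaussian_transform (q := q) (n k) (τ k)
  rw [hpic] at hk
  have : ∫ v : ZeroSum q, Complex.exp (-(1 / 2) * ‖v‖ ^ 2) *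
      ((∑ c, Complex.exp (τ k * v.1 c * Complex.I)) / q) ^ n k =
      (((2 * Real.pi) ^ (d / 2) * ((∑ t : Fin (n k) → Fin q,
        Real.exp (-(τ k ^ 2 / 2 * ‖deviation t‖ ^ 2))) / (q : ℝ) ^ n k) : ℝ) : ℂ) := by
    simp only [div_pow, ← mul_div_assoc]
    rw [MeasureTheory.integral_div, ← hk]
    push_cast
    rfl
  rw [Function.comp_apply, this, Complex.ofReal_re, inv_mul_cancel_left₀ hpi.ne']

end Limits

/-! ### Elementary estimates -/

theorem one_sub_pow_le_exp_neg {u : ℝ} (h1 : u ≤ 1) (m : ℕ) :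
    (1 - u) ^ m ≤ Real.exp (-(m * u)) := by
  calc (1 - u) ^ m ≤ Real.exp (-u) ^ m :=
        pow_le_pow_left₀ (by linarith) (Real.one_sub_le_exp_neg u) m
    _ = _ := by rw [← Real.exp_nat_mul]; ring_nf

/-- Replacing `(1 - u) ^ m` by `exp (-m * u)` costs `O(1 / m)`, uniformly in `u ∈ [0, 1]`. -/
theorem exp_neg_sub_one_sub_pow_le {u : ℝ} (h0 : 0 ≤ u) (h1 : u ≤ 1) {m : ℕ} (hm : m ≠ 0) :
    Real.exp (-(m * u)) - (1 - u) ^ m ≤ 2 / m := by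
  have hm0 : (0 : ℝ) < m := by positivity
  have hpow : 1 - m * u ^ 2 ≤ ((1 - u) * Real.exp u) ^ m := by
    calc 1 - m * u ^ 2 = 1 + m * (-u ^ 2) := by ring
      _ ≤ (1 + -u ^ 2) ^ m := one_add_mul_le_pow (by nlinarith) m
      _ ≤ _ := by
          refine pow_le_pow_left₀ (by nlinarith) ?_ m
          have := Real.add_one_le_exp u
          nlinarith
  have hE : Real.exp (-(m * u)) * Real.exp (m * u) = 1 := by rw [← Real.exp_add]; simp
  have hEpos := Real.exp_pos (-(m * u))
  rw [mul_pow, ← Real.exp_nat_mul] at hpow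
  have h2 : (m * u) ^ 2 / 2 ≤ Real.exp (m * u) := by
    have := Real.quadratic_le_exp_of_nonneg (x := m * u) (by positivity)
    have : 0 ≤ m * u := by positivity
    linarith
  rw [le_div_iff₀ hm0]
  have h3 : Real.exp (-(m * u)) * (1 - m * u ^ 2) ≤ (1 - u) ^ m := by
    calc _ ≤ Real.exp (-(m * u)) * ((1 - u) ^ m * Real.exp (m * u)) := by gcongr
      _ = (1 - u) ^ m * (Real.exp (-(m * u)) * Real.exp (m * u)) := by ring
      _ = _ := by rw [hE, mul_one]
  have h4 : Real.exp (-(m * u)) * ((m * u) ^ 2 / 2) ≤ 1 :=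
    (mul_le_mul_of_nonneg_left h2 hEpos.le).trans hE.le
  nlinarith

/-- The probability that `m` independent uniform elements of a set of `b` elements are distinct.
For `b = 0` the value is `1` if `m = 0` and, by division by zero, `0` otherwise. -/
noncomputable def distinctProb (b m : ℕ) : ℝ := (b.descFactorial m : ℝ) / (b : ℝ) ^ m

theorem distinctProb_nonneg (b m : ℕ) : 0 ≤ distinctProb b m := by
  unfold distinctProb; positivity

theorem distinctProb_le_one (b m : ℕ) : distinctProb b m ≤ 1 :=
  div_le_one_of_le₀ (by exact_mod_cast Nat.descFactorial_le_pow b m) (by positivity)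

theorem pow_mul_distinctProb (b m : ℕ) :
    (b : ℝ) ^ m * distinctProb b m = b.descFactorial m := by
  by_cases h : (b : ℝ) ^ m = 0
  · have hle : (b.descFactorial m : ℝ) ≤ (b : ℝ) ^ m := by
      exact_mod_cast Nat.descFactorial_le_pow b m
    rw [h] at hle ⊢
    rw [zero_mul]
    exact (le_antisymm hle (by positivity)).symm
  · rw [distinctProb, mul_div_cancel₀ _ h]

theorem distinctProb_eq_prod (b m : ℕ) :
    distinctProb b m = ∏ i ∈ Finset.range m, ((b - i : ℕ) : ℝ) / b := by
  rw [distinctProb, Nat.descFactorial_eq_prod_range, Finset.prod_div_distrib]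
  simp

theorem sum_range_natCast (m : ℕ) : ∑ i ∈ Finset.range m, (i : ℝ) = m * (m - 1) / 2 := by
  induction m with
  | zero => simp
  | succ m ih => rw [Finset.sum_range_succ, ih]; push_cast; ring

theorem distinctProb_le_exp {b : ℕ} (hb : 0 < b) {B : ℝ} (hB : b ≤ B) (m : ℕ) :
    distinctProb b m ≤ Real.exp (-(m * (m - 1) / (2 * B))) := by
  have hb0 : (0 : ℝ) < b := by exact_mod_cast hb
  have hsum : ∑ i ∈ Finset.range m, -((i : ℝ) / B) = -(m * (m - 1) / (2 * B)) := by
    rw [Finset.sum_neg_distrib, ← Finset.sum_div, sum_range_natCast, div_div]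
  rw [distinctProb_eq_prod, ← hsum, Real.exp_sum]
  refine Finset.prod_le_prod (fun i _ => by positivity) fun i _ => ?_
  rcases le_total b i with h | h
  · rw [Nat.sub_eq_zero_of_le h]
    simpa using (Real.exp_pos _).le
  · rw [Nat.cast_sub h, sub_div, div_self hb0.ne']
    calc 1 - (i : ℝ) / b ≤ 1 - i / B := by gcongr
      _ ≤ _ := Real.one_sub_le_exp_neg _

theorem exp_le_distinctProb {b m : ℕ} {B : ℝ} (hB0 : 0 < B) (hB : B ≤ b) (hm : 2 * m ≤ B) :
    Real.exp (-(m ^ 2 / (2 * B) + 2 * m ^ 3 / B ^ 2)) ≤ distinctProb b m := by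
  have hb0 : (0 : ℝ) < b := hB0.trans_le hB
  have hsum : -(m ^ 2 / (2 * B) + 2 * m ^ 3 / B ^ 2) ≤
      ∑ i ∈ Finset.range m, -((i : ℝ) / B + 2 * m ^ 2 / B ^ 2) := by
    rw [Finset.sum_neg_distrib, Finset.sum_add_distrib, ← Finset.sum_div, sum_range_natCast,
      div_div, neg_le_neg_iff, Finset.sum_const, Finset.card_range, nsmul_eq_mul]
    gcongr
    · nlinarith [(Nat.cast_nonneg m : (0 : ℝ) ≤ m)]
    · exact le_of_eq (by ring)
  rw [distinctProb_eq_prod]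
  refine (Real.exp_le_exp.2 hsum).trans ?_
  rw [Real.exp_sum]
  refine Finset.prod_le_prod (fun i _ => (Real.exp_pos _).le) fun i hi => ?_
  have him : (i : ℝ) ≤ m := by exact_mod_cast (Finset.mem_range.1 hi).le
  have hib : (i : ℝ) ≤ b := by linarith [(Nat.cast_nonneg m : (0 : ℝ) ≤ m)]
  rw [Nat.cast_sub (by exact_mod_cast hib), sub_div, div_self hb0.ne']
  set x : ℝ := i / B with hx
  have hx0 : 0 ≤ x := by positivity
  have hx2 : x ≤ 1 / 2 := by rw [hx, div_le_iff₀ hB0]; linarith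
  have hxm : 2 * x ^ 2 ≤ 2 * m ^ 2 / B ^ 2 := by
    rw [hx, div_pow, ← mul_div_assoc]; gcongr
  have hpos : 0 < 1 - x := by linarith
  have hlog : -(x + 2 * x ^ 2) ≤ Real.log (1 - x) := by
    refine le_trans ?_ (Real.one_sub_inv_le_log_of_pos hpos)
    rw [neg_le, neg_sub, sub_le_iff_le_add, inv_le_iff_one_le_mul₀ hpos]
    nlinarith [mul_nonneg (sq_nonneg x) (by linarith : 0 ≤ 1 / 2 - x)]
  calc Real.exp (-(x + 2 * m ^ 2 / B ^ 2)) ≤ Real.exp (Real.log (1 - x)) :=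
        Real.exp_le_exp.2 (by linarith)
    _ = 1 - i / B := by rw [Real.exp_log hpos]
    _ ≤ 1 - i / b := by gcongr

/-- A property of pairs `(n, m)` that holds eventually along all sequences with `n → ∞` and `m / n`
convergent in a compact set holds uniformly for `n` large and `m / n` in this set. -/
theorem exists_forall_of_eventually {K : Set ℝ} (hK : IsCompact K) {P : ℕ → ℕ → Prop}
    (h : ∀ (n m : ℕ → ℕ) (α : ℝ), α ∈ K → Tendsto n atTop atTop →
      Tendsto (fun k => (m k : ℝ) / n k) atTop (𝓝 α) → ∀ᶠ k in atTop, P (n k) (m k)) :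
    ∃ N : ℕ, ∀ n m : ℕ, N ≤ n → (m : ℝ) / (n : ℝ) ∈ K → P n m := by
  by_contra! hcon
  choose n m hn hmK hP using hcon
  obtain ⟨α, hα, φ, hφ, hlim⟩ := hK.tendsto_subseq hmK
  have hn' : Tendsto n atTop atTop := tendsto_atTop_mono hn tendsto_id
  obtain ⟨k, hk⟩ := (h (n ∘ φ) (m ∘ φ) α hα (hn'.comp hφ.tendsto_atTop) hlim).exists
  exact hP _ hk

/-! ### Asymptotics of the averages over colourings -/

/-- The relative defect of the number of bichromatic pairs of vertices, compared with a perfectly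
balanced colouring; this meaning requires `n ≠ 0`. -/
noncomputable def imbalance {q n : ℕ} (t : Fin n → Fin q) : ℝ :=
  (q : ℝ) / (q - 1) * (‖deviation t‖ ^ 2 / (n : ℝ) ^ 2)

section Imbalance

variable {q n : ℕ}

theorem one_lt_cast_of_two_le (hq : 2 ≤ q) : (1 : ℝ) < q := by exact_mod_cast hq

theorem imbalance_nonneg (hq : 2 ≤ q) (t : Fin n → Fin q) : 0 ≤ imbalance t := by
  have := one_lt_cast_of_two_le hq
  have : (0 : ℝ) < q - 1 := by linarith
  unfold imbalance
  positivity

theorem cast_card_bichromaticPairs (hq : 2 ≤ q) (hn : n ≠ 0) (t : Fin n → Fin q) :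
    ((bichromaticPairs t).card : ℝ) = (n : ℝ) ^ 2 * (1 - 1 / q) * (1 - imbalance t) := by
  have h : ((bichromaticPairs t).card : ℝ) + ∑ c, (colorCount t c : ℝ) ^ 2 = (n : ℝ) ^ 2 := by
    exact_mod_cast card_bichromaticPairs_add t
  have hdev := norm_sq_deviation hq t
  have hq1 := one_lt_cast_of_two_le hq
  have hq0 : (q : ℝ) ≠ 0 := by linarith
  have hq2 : (q : ℝ) - 1 ≠ 0 := by linarith
  have hn0 : (n : ℝ) ≠ 0 := by exact_mod_cast hn
  have hS : ∑ c, (colorCount t c : ℝ) ^ 2 = ‖deviation t‖ ^ 2 + (n : ℝ) ^ 2 / q := by linarith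
  rw [hS] at h
  rw [eq_sub_of_add_eq h, imbalance]
  field_simp
  ring

theorem imbalance_le_one (hq : 2 ≤ q) (hn : n ≠ 0) (t : Fin n → Fin q) : imbalance t ≤ 1 := by
  have h := cast_card_bichromaticPairs hq hn t
  have hq1 := one_lt_cast_of_two_le hq
  have hpos : 0 < (n : ℝ) ^ 2 * (1 - 1 / q) := by
    have : 1 / (q : ℝ) < 1 := by rw [div_lt_one] <;> linarith
    have : (0 : ℝ) < 1 - 1 / q := by linarith
    positivity
  have h0 : 0 ≤ (n : ℝ) ^ 2 * (1 - 1 / q) * (1 - imbalance t) := h ▸ Nat.cast_nonneg _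
  linarith [nonneg_of_mul_nonneg_right h0 hpos]

/-- The average of a function over all colourings of `n` vertices with `q` colours. -/
noncomputable def coloringAverage (q n : ℕ) (f : (Fin n → Fin q) → ℝ) : ℝ :=
  (∑ t, f t) / (q : ℝ) ^ n

theorem coloringAverage_sub (f g : (Fin n → Fin q) → ℝ) :
    coloringAverage q n f - coloringAverage q n g = coloringAverage q n fun t => f t - g t := by
  simp [coloringAverage, sub_div]

theorem coloringAverage_const_mul (a : ℝ) (f : (Fin n → Fin q) → ℝ) :
    coloringAverage q n (fun t => a * f t) = a * coloringAverage q n f := by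
  simp [coloringAverage, ← Finset.mul_sum, mul_div_assoc]

theorem abs_coloringAverage_le (hq : 2 ≤ q) {f : (Fin n → Fin q) → ℝ} {C : ℝ}
    (h : ∀ t, |f t| ≤ C) : |coloringAverage q n f| ≤ C := by
  have hq0 : (0 : ℝ) < (q : ℝ) ^ n := by positivity
  rw [coloringAverage, abs_div, abs_of_pos hq0, div_le_iff₀ hq0]
  refine (Finset.abs_sum_le_sum_abs _ _).trans ((Finset.sum_le_sum fun t _ => h t).trans ?_)
  simp [mul_comm]

/-- What the number of properly coloured multigraphs would be if each of the `q ^ n` colourings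
were perfectly balanced, that is, had `n ^ 2 * (1 - 1 / q)` bichromatic pairs. -/
noncomputable def balancedCount (q n m : ℕ) : ℝ :=
  (n : ℝ) ^ (2 * m) / (2 ^ m * (m.factorial : ℝ)) * (1 - 1 / (q : ℝ)) ^ m * (q : ℝ) ^ n

theorem numProperlyColored_eq_average (hq : 2 ≤ q) (hn : n ≠ 0) (m : ℕ) :
    numProperlyColored q n m =
      balancedCount q n m * coloringAverage q n fun t => (1 - imbalance t) ^ m := by
  have hq0 : (q : ℝ) ^ n ≠ 0 := by positivity
  rw [numProperlyColored_eq_sum, coloringAverage, balancedCount, mul_assoc, mul_div_cancel₀ _ hq0,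
    Finset.mul_sum]
  refine Finset.sum_congr rfl fun t _ => ?_
  rw [cast_card_bichromaticPairs hq hn, mul_pow, mul_pow, ← pow_mul]
  ring

theorem numProperlyColoredSimple_eq_average (hq : 2 ≤ q) (hn : n ≠ 0) (m : ℕ) :
    numProperlyColoredSimple q n m = balancedCount q n m * coloringAverage q n fun t =>
      (1 - imbalance t) ^ m * distinctProb (bichromaticEdges t).card m := by
  have hq0 : (q : ℝ) ^ n ≠ 0 := by positivity
  rw [numProperlyColoredSimple_eq_sum, coloringAverage, balancedCount, mul_assoc,
    mul_div_cancel₀ _ hq0, Finset.mul_sum]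
  refine Finset.sum_congr rfl fun t _ => ?_
  have hcard : ((bichromaticEdges t).card : ℝ) * 2 =
      (n : ℝ) ^ 2 * (1 - 1 / q) * (1 - imbalance t) := by
    rw [← cast_card_bichromaticPairs hq hn, card_bichromaticPairs]
    push_cast
    rfl
  rw [← pow_mul_distinctProb, mul_right_comm, ← mul_pow, hcard, mul_pow, mul_pow, ← pow_mul]
  ring

end Imbalance

section Asymptotics

variable {q : ℕ} {n m : ℕ → ℕ} {α : ℝ}

theorem tendsto_natCast_of_tendsto_div (hα : 0 < α) (hn : Tendsto n atTop atTop)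
    (h : Tendsto (fun k => (m k : ℝ) / n k) atTop (𝓝 α)) :
    Tendsto (fun k => (m k : ℝ)) atTop atTop := by
  have hn' : Tendsto (fun k => (n k : ℝ)) atTop atTop := tendsto_natCast_atTop_atTop.comp hn
  refine (hn'.atTop_mul_pos hα h).congr' ?_
  filter_upwards [hn.eventually_ge_atTop 1] with k hk
  have : (n k : ℝ) ≠ 0 := by exact_mod_cast (by omega : n k ≠ 0)
  field_simp

theorem tendsto_average_exp_imbalance (hq : 2 ≤ q) (hα : 0 < α) (hn : Tendsto n atTop atTop)
    (h : Tendsto (fun k => (m k : ℝ) / n k) atTop (𝓝 α)) :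
    Tendsto (fun k => coloringAverage q (n k) fun t => Real.exp (-(m k * imbalance t))) atTop
      (𝓝 ((1 + 2 / ((q : ℝ) - 1) * α) ^ (-(((q : ℝ) - 1) / 2)))) := by
  have hq1 := one_lt_cast_of_two_le hq
  have hd : (0 : ℝ) < q - 1 := by linarith
  have hq0 : (0 : ℝ) < q := by linarith
  -- the scale at which `τ ^ 2 / 2 * ‖deviation t‖ ^ 2 = m * imbalance t`
  set τ : ℕ → ℝ := fun k => √(2 * (q / (q - 1)) * (m k / n k) * (n k : ℝ)⁻¹) with hτdef
  have hτsq (k : ℕ) : τ k ^ 2 = 2 * (q / (q - 1)) * (m k / n k) * (n k : ℝ)⁻¹ :=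
    Real.sq_sqrt (by positivity)
  have hninv : Tendsto (fun k => ((n k : ℝ))⁻¹) atTop (𝓝 0) :=
    (tendsto_inv_atTop_nhds_zero_nat (𝕜 := ℝ)).comp hn
  have hτ : Tendsto τ atTop (𝓝 0) := by
    have := ((h.const_mul (2 * ((q : ℝ) / (q - 1)))).mul hninv).sqrt
    rwa [mul_zero, Real.sqrt_zero] at this
  have hσ : Tendsto (fun k => n k * τ k ^ 2) atTop (𝓝 (2 * ((q : ℝ) / (q - 1)) * α)) := by
    refine (h.const_mul (2 * ((q : ℝ) / (q - 1)))).congr' ?_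
    filter_upwards [hn.eventually_ge_atTop 1] with k hk
    have : (n k : ℝ) ≠ 0 := by exact_mod_cast (by omega : n k ≠ 0)
    rw [hτsq]
    field_simp
  have hlim := tendsto_laplace_deviation hq (by positivity) hn hτ hσ
  convert hlim using 2 with k
  · rw [coloringAverage]
    congr 2
    funext t
    rw [hτsq, imbalance]
    congr 2
    simp only [div_eq_mul_inv, sq, mul_inv]
    ring
  · congr 1
    field_simp

theorem tendsto_average_pow_imbalance (hq : 2 ≤ q) (hα : 0 < α) (hn : Tendsto n atTop atTop)
    (h : Tendsto (fun k => (m k : ℝ) / n k) atTop (𝓝 α)) :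
    Tendsto (fun k => coloringAverage q (n k) fun t => (1 - imbalance t) ^ m k) atTop
      (𝓝 ((1 + 2 / ((q : ℝ) - 1) * α) ^ (-(((q : ℝ) - 1) / 2)))) := by
  have hm := tendsto_natCast_of_tendsto_div hα hn h
  have hdiff : Tendsto (fun k => (coloringAverage q (n k) fun t => (1 - imbalance t) ^ m k) -
      coloringAverage q (n k) fun t => Real.exp (-(m k * imbalance t))) atTop (𝓝 0) := by
    refine squeeze_zero_norm' ?_ (hm.const_div_atTop 2)
    filter_upwards [hn.eventually_ge_atTop 1, hm.eventually_ge_atTop 1] with k hk hk'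
    have hmk : m k ≠ 0 := by rintro h0; rw [h0] at hk'; norm_num at hk'
    rw [coloringAverage_sub]
    refine abs_coloringAverage_le hq fun t => ?_
    have h1 := imbalance_le_one hq (by omega) t
    rw [abs_sub_comm, abs_of_nonneg (sub_nonneg.2 (one_sub_pow_le_exp_neg h1 _))]
    exact exp_neg_sub_one_sub_pow_le (imbalance_nonneg hq t) h1 hmk
  simpa using hdiff.add (tendsto_average_exp_imbalance hq hα hn h)

/-- Conditioning on the absence of multiple edges: up to colourings whose total contribution is
exponentially small, the number of bichromatic edges is that of a balanced colouring, so that the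
probability of distinctness of the edges may be replaced by its limit. -/
theorem tendsto_average_distinctProb (hq : 2 ≤ q) (hα : 0 < α) (hn : Tendsto n atTop atTop)
    (h : Tendsto (fun k => (m k : ℝ) / n k) atTop (𝓝 α)) :
    Tendsto (fun k => coloringAverage q (n k) fun t =>
      (1 - imbalance t) ^ m k * distinctProb (bichromaticEdges t).card (m k)) atTop
      (𝓝 ((1 + 2 / ((q : ℝ) - 1) * α) ^ (-(((q : ℝ) - 1) / 2)) *
        Real.exp (-(α ^ 2 * ((q : ℝ) / (q - 1)))))) := by
  have hq1 := one_lt_cast_of_two_le hq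
  have hd : (0 : ℝ) < q - 1 := by linarith
  have hq0 : (0 : ℝ) < q := by linarith
  have hm := tendsto_natCast_of_tendsto_div hα hn h
  have hn' : Tendsto (fun k => (n k : ℝ)) atTop atTop := tendsto_natCast_atTop_atTop.comp hn
  have hninv : Tendsto (fun k => ((n k : ℝ))⁻¹) atTop (𝓝 0) := tendsto_inv_atTop_zero.comp hn'
  set p : ℝ := Real.exp (-(α ^ 2 * ((q : ℝ) / (q - 1)))) with hp
  have hp0 : 0 ≤ p := (Real.exp_pos _).le
  have hp1 : p ≤ 1 := Real.exp_le_one_iff.2 (neg_nonpos.2 (by positivity))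
  -- colourings with imbalance above `δ` contribute at most `exp (-m * δ) = exp (-√m)`
  set δ : ℕ → ℝ := fun k => (√(m k))⁻¹ with hδ
  have hsqrt : Tendsto (fun k => √(m k : ℝ)) atTop atTop := Real.tendsto_sqrt_atTop.comp hm
  have hδ0 : Tendsto δ atTop (𝓝 0) := tendsto_inv_atTop_zero.comp hsqrt
  set c : ℝ := (1 - 1 / q) / 2 with hc
  have hc0 : 0 < c := by
    have : 1 / (q : ℝ) < 1 := by rw [div_lt_one] <;> linarith
    have : (0 : ℝ) < 1 - 1 / q := by linarith
    positivity
  have hcq : 1 / (2 * c) = (q : ℝ) / (q - 1) := by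
    rw [hc]; field_simp
  -- upper and lower bounds of the number of bichromatic edges of the other colourings
  set B : ℕ → ℝ := fun k => c * (n k : ℝ) ^ 2 with hB
  set A : ℕ → ℝ := fun k => B k * (1 - δ k) with hA
  have hcard (k : ℕ) (hk : n k ≠ 0) (t : Fin (n k) → Fin q) :
      ((bichromaticEdges t).card : ℝ) = B k * (1 - imbalance t) := by
    have h1 := cast_card_bichromaticPairs hq hk t
    rw [card_bichromaticPairs] at h1
    push_cast at h1
    rw [hB, hc]
    linear_combination h1 / 2
  have hU : Tendsto (fun k => Real.exp (-(m k * (m k - 1) / (2 * B k)))) atTop (𝓝 p) := by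
    refine (Real.continuous_exp.tendsto _).comp (Tendsto.neg ?_)
    have := (h.mul (h.sub hninv)).mul_const (1 / (2 * c))
    rw [sub_zero, hcq, ← sq] at this
    refine this.congr' ?_
    filter_upwards [hn.eventually_ge_atTop 1] with k hk
    have : (n k : ℝ) ≠ 0 := by exact_mod_cast (by omega : n k ≠ 0)
    rw [hB, ← hcq]
    field_simp
  have hδ1 : Tendsto (fun k => 1 - δ k) atTop (𝓝 1) := by simpa using hδ0.const_sub 1
  have hδhalf : ∀ᶠ k in atTop, 1 / 2 < 1 - δ k := hδ1.eventually_const_lt (by norm_num)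
  have hL : Tendsto (fun k => Real.exp (-((m k : ℝ) ^ 2 / (2 * A k) +
      2 * (m k : ℝ) ^ 3 / A k ^ 2))) atTop (𝓝 p) := by
    refine (Real.continuous_exp.tendsto _).comp (Tendsto.neg ?_)
    have hinv : Tendsto (fun k => (1 - δ k)⁻¹) atTop (𝓝 1) := by
      simpa using hδ1.inv₀ one_ne_zero
    have h1 := ((h.pow 2).mul_const (1 / (2 * c))).mul hinv
    have h2 := (((h.pow 3).const_mul (2 / c ^ 2)).mul hninv).mul (hinv.pow 2)
    have := h1.add h2
    rw [hcq] at this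
    simp only [mul_one, mul_zero, zero_mul, add_zero] at this
    refine this.congr' ?_
    filter_upwards [hn.eventually_ge_atTop 1, hδhalf] with k hk hk'
    have : (n k : ℝ) ≠ 0 := by exact_mod_cast (by omega : n k ≠ 0)
    have : 1 - δ k ≠ 0 := by linarith
    simp only [hA, hB, ← hcq]
    field_simp
  have hlarge : ∀ᶠ k in atTop, 2 * (m k : ℝ) ≤ A k := by
    have hlim : Tendsto (fun k => c * (1 - δ k) * n k) atTop atTop :=
      Tendsto.pos_mul_atTop (by positivity : 0 < c * 1) (hδ1.const_mul c) hn'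
    filter_upwards [hn.eventually_ge_atTop 1, hlim.eventually_ge_atTop (2 * (α + 1)),
      h.eventually_le_const (by linarith : α < α + 1)] with k hk h1 h2
    have hnk : (0 : ℝ) < n k := by exact_mod_cast (by omega : 0 < n k)
    rw [div_le_iff₀ hnk] at h2
    calc 2 * (m k : ℝ) ≤ 2 * (α + 1) * n k := by linarith
      _ ≤ c * (1 - δ k) * n k * n k := by gcongr
      _ = A k := by rw [hA, hB]; ring
  have hbound : Tendsto (fun k => Real.exp (-√(m k : ℝ)) +
      (|Real.exp (-(m k * (m k - 1) / (2 * B k))) - p| +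
      |Real.exp (-((m k : ℝ) ^ 2 / (2 * A k) + 2 * (m k : ℝ) ^ 3 / A k ^ 2)) - p|))
      atTop (𝓝 0) := by
    have h1 : Tendsto (fun k => Real.exp (-√(m k : ℝ))) atTop (𝓝 0) :=
      Real.tendsto_exp_neg_atTop_nhds_zero.comp hsqrt
    simpa using h1.add ((hU.sub_const p).abs.add (hL.sub_const p).abs)
  have hdiff : Tendsto (fun k => (coloringAverage q (n k) fun t =>
      (1 - imbalance t) ^ m k * distinctProb (bichromaticEdges t).card (m k)) -
      p * coloringAverage q (n k) fun t => (1 - imbalance t) ^ m k) atTop (𝓝 0) := by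
    refine squeeze_zero_norm' ?_ hbound
    filter_upwards [hn.eventually_ge_atTop 1, hδhalf, hlarge] with k hk hk' hk2
    rw [← coloringAverage_const_mul, coloringAverage_sub]
    refine abs_coloringAverage_le hq fun t => ?_
    have hnk : (0 : ℝ) < n k := by exact_mod_cast (by omega : 0 < n k)
    have hBk : 0 < B k := by rw [hB]; positivity
    have hAk : 0 < A k := mul_pos hBk (by linarith)
    have hu0 := imbalance_nonneg hq t
    have hu1 := imbalance_le_one hq (by omega) t
    have hw0 : 0 ≤ (1 - imbalance t) ^ m k := pow_nonneg (by linarith) _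
    have hw1 : (1 - imbalance t) ^ m k ≤ 1 := pow_le_one₀ (by linarith) (by linarith)
    set Q := distinctProb (bichromaticEdges t).card (m k) with hQ
    have hQ0 : 0 ≤ Q := distinctProb_nonneg _ _
    have hQ1 : Q ≤ 1 := distinctProb_le_one _ _
    rw [mul_comm p, ← mul_sub, abs_mul, abs_of_nonneg hw0]
    rcases le_total (imbalance t) (δ k) with hut | hut
    · have hA' : A k ≤ (bichromaticEdges t).card := by
        rw [hcard k (by omega)]
        exact mul_le_mul_of_nonneg_left (by linarith) hBk.le
      have hB' : ((bichromaticEdges t).card : ℝ) ≤ B k := by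
        rw [hcard k (by omega)]
        exact mul_le_of_le_one_right hBk.le (by linarith)
      have hupper := distinctProb_le_exp (by exact_mod_cast hAk.trans_le hA') hB' (m k)
      have hlower := exp_le_distinctProb hAk hA' hk2
      refine (mul_le_of_le_one_left (abs_nonneg _) hw1).trans ?_
      refine le_add_of_nonneg_of_le (Real.exp_pos _).le (abs_le.2 ⟨?_, ?_⟩)
      · linarith [neg_abs_le (Real.exp (-((m k : ℝ) ^ 2 / (2 * A k) +
          2 * (m k : ℝ) ^ 3 / A k ^ 2)) - p),
          abs_nonneg (Real.exp (-(m k * (m k - 1) / (2 * B k))) - p)]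
      · linarith [le_abs_self (Real.exp (-(m k * (m k - 1) / (2 * B k))) - p),
          abs_nonneg (Real.exp (-((m k : ℝ) ^ 2 / (2 * A k) +
          2 * (m k : ℝ) ^ 3 / A k ^ 2)) - p)]
    · have habs : |Q - p| ≤ 1 := abs_le.2 ⟨by linarith, by linarith⟩
      have hmδ : (m k : ℝ) * δ k = √(m k : ℝ) := by
        rw [hδ, ← div_eq_mul_inv, Real.div_sqrt]
      have hexp : (1 - imbalance t) ^ m k ≤ Real.exp (-√(m k : ℝ)) := by
        refine (one_sub_pow_le_exp_neg hu1 _).trans (Real.exp_le_exp.2 (neg_le_neg ?_))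
        rw [← hmδ]
        gcongr
      exact (mul_le_of_le_one_right hw0 habs).trans
        (hexp.trans (le_add_of_nonneg_right (by positivity)))
  have hprod := (tendsto_average_pow_imbalance hq hα hn h).const_mul p
  have := hdiff.add hprod
  rw [zero_add, mul_comm p] at this
  exact this.congr fun k => by ring

end Asymptotics

/-! ### Uniform asymptotics -/

/-- Two quantities with a common prefactor and the same positive limit are equivalent. -/
theorem eventually_abs_sub_le {C X Y : ℕ → ℝ} {L ε : ℝ} (hε : 0 < ε) (hL : 0 < L)
    (hC : ∀ k, 0 ≤ C k) (hX : Tendsto X atTop (𝓝 L)) (hY : Tendsto Y atTop (𝓝 L)) :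
    ∀ᶠ k in atTop, |C k * X k - C k * Y k| ≤ ε * (C k * Y k) := by
  have h1 : Tendsto (fun k => |X k - Y k|) atTop (𝓝 0) := by simpa using (hX.sub hY).abs
  have h2 : Tendsto (fun k => ε * Y k) atTop (𝓝 (ε * L)) := hY.const_mul ε
  filter_upwards [h1.eventually_lt h2 (by positivity)] with k hk
  rw [← mul_sub, abs_mul, abs_of_nonneg (hC k), mul_left_comm]
  exact mul_le_mul_of_nonneg_left hk.le (hC k)

theorem balancedCount_nonneg {q : ℕ} (hq : 2 ≤ q) (n m : ℕ) : 0 ≤ balancedCount q n m := by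
  have hq1 := one_lt_cast_of_two_le hq
  have : 1 / (q : ℝ) < 1 := by rw [div_lt_one] <;> linarith
  have : (0 : ℝ) < 1 - 1 / q := by linarith
  unfold balancedCount
  positivity

theorem coloredAsymptotics_eq (q n m : ℕ) :
    coloredAsymptotics q n m = balancedCount q n m *
      (1 + 2 / ((q : ℝ) - 1) * ((m : ℝ) / (n : ℝ))) ^ (-(((q : ℝ) - 1) / 2)) := by
  unfold coloredAsymptotics balancedCount
  ring


theorem mainTheorem4 (q : ℕ) (hq : 2 ≤ q) :
    (∀ n m : ℕ, numProperlyColored q n m = (colModel q hq).numGraphs n m) ∧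
    (∀ K : Set ℝ, IsCompact K → K ⊆ Set.Ioi 0 →
      (∀ ε : ℝ, 0 < ε → ∃ N : ℕ, ∀ n m : ℕ, N ≤ n → (m : ℝ) / (n : ℝ) ∈ K →
        |numProperlyColored q n m - coloredAsymptotics q n m| ≤ ε * coloredAsymptotics q n m) ∧
      (∀ ε : ℝ, 0 < ε → ∃ N : ℕ, ∀ n m : ℕ, N ≤ n → (m : ℝ) / (n : ℝ) ∈ K →
        |numProperlyColoredSimple q n m -
            coloredAsymptotics q n m *
              Real.exp (-(((m : ℝ) / (n : ℝ)) ^ 2 * ((q : ℝ) / ((q : ℝ) - 1))))| ≤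
          ε * (coloredAsymptotics q n m *
              Real.exp (-(((m : ℝ) / (n : ℝ)) ^ 2 * ((q : ℝ) / ((q : ℝ) - 1))))))) := by
  refine ⟨numProperlyColored_eq_numGraphs q hq, fun K hK hK0 => ?_⟩
  have hq1 := one_lt_cast_of_two_le hq
  have hd : (0 : ℝ) < q - 1 := by linarith
  have hF {n m : ℕ → ℕ} {α : ℝ} (hα : 0 < α)
      (h : Tendsto (fun k => (m k : ℝ) / n k) atTop (𝓝 α)) :
      Tendsto (fun k => (1 + 2 / ((q : ℝ) - 1) * ((m k : ℝ) / n k)) ^ (-(((q : ℝ) - 1) / 2))) atTop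
        (𝓝 ((1 + 2 / ((q : ℝ) - 1) * α) ^ (-(((q : ℝ) - 1) / 2)))) :=
    ((h.const_mul _).const_add 1).rpow_const (Or.inl (by positivity))
  constructor
  · intro ε hε
    refine exists_forall_of_eventually hK fun n m α hαK hn h => ?_
    have hα : 0 < α := hK0 hαK
    filter_upwards [hn.eventually_ge_atTop 1, eventually_abs_sub_le hε (by positivity)
      (fun k => balancedCount_nonneg hq (n k) (m k)) (tendsto_average_pow_imbalance hq hα hn h)
      (hF hα h)] with k hk hk'
    rwa [numProperlyColored_eq_average hq (by omega), coloredAsymptotics_eq]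
  · intro ε hε
    refine exists_forall_of_eventually hK fun n m α hαK hn h => ?_
    have hα : 0 < α := hK0 hαK
    have hexp : Tendsto (fun k => Real.exp (-(((m k : ℝ) / n k) ^ 2 * ((q : ℝ) / (q - 1))))) atTop
        (𝓝 (Real.exp (-(α ^ 2 * ((q : ℝ) / (q - 1)))))) :=
      (Real.continuous_exp.tendsto _).comp ((h.pow 2).mul_const _).neg
    filter_upwards [hn.eventually_ge_atTop 1, eventually_abs_sub_le hε (by positivity)
      (fun k => balancedCount_nonneg hq (n k) (m k)) (tendsto_average_distinctProb hq hα hn h)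
      ((hF hα h).mul hexp)] with k hk hk'
    rwa [numProperlyColoredSimple_eq_average hq (by omega), coloredAsymptotics_eq, mul_assoc]
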